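/- Let $m,n\ge 2$, let $\mathbb A=(a_{i_1i_2\ldots i_m})$ be a real tensor of order $m$ and dimension $n$ with nonnegative entries and $a_{ii\ldots i}=0$ for all $i\in[n]=\{1,\ldots,n\}$. Assume that $\mathbb A$ is weakly irreducible: there is no nonempty proper subset $I\subset[n]$ such that $a_{i_1i_2\ldots i_m}=0$ whenever $i_1\in I$ and at least one of $i_2,\ldots,i_m$ is not in $I$. For $i\in[n]$ let $N(i)$ be the set of all $j\in[n]$ that occur among $i_2,\ldots,i_m$ for some nonzero entry $a_{ii_2\ldots i_m}$. Let $R_i>0$ and $t_i\ge 0$ for $i\in[n]$, put $$S_i=\sum_{i_2,\ldots,i_m=1}^n a_{ii_2\ldots i_m}R_{i_2}\cdots R_{i_m},\qquad F(i,j)=\frac{t_i+t_j+\sqrt{(t_i-t_j)^2+\frac{4S_iS_j}{(R_iR_j)^{m-1}}}}{2},$$ and let $\mathbb B=\mathbb A+\mathbb M$, where $\mathbb M$ is the diagonal tensor with diagonal entries $t_1,\ldots,t_n$. Let $\rho(\mathbb B)$ be the spectral radius of $\mathbb B$, that is, the maximum of $|\lambda|$ over all $\lambda\in\mathbb C$ for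 which there is a nonzero $x\in\mathbb C^n$ with $\sum_{i_2,\ldots,i_m=1}^n b_{ii_2\ldots i_m}x_{i_2}\cdots x_{i_m}=\lambda x_i^{m-1}$ for all $i\in[n]$ (this maximum exists). Then $$\min\{F(i,j): i,j\in[n],\ j\in N(i)\}\ \le\ \rho(\mathbb B)\ \le\ \max\{F(i,j): i,j\in[n],\ j\in N(i)\}.$$ Moreover, the left equality holds if and only if at least one of the following conditions (i), (ii) holds, and likewise the right equality holds if and only if (i) or (ii) holds: (i) $t_i+\dfrac{S_i}{R_i^{m-1}}=t_j+\dfrac{S_j}{R_j^{m-1}}$ for all $i,j\in[n]$; (ii) there exist subsets $U,W$ of $[n]$ and a real $\ell>0$ such that (1) $[n]=U\cup W$ and $U\cap W=\emptyset$; (2) $a_{i_1i_2\ldots i_m}\ne 0$ only when $i_1\in U$ and $i_2,\ldots,i_m\in W$, or $i_1\in W$ and $i_2,\ldots,i_m\in U$; (3) $\rho(\mathbb B)=t_i+\dfrac{\ell^{m-1}S_i}{R_i^{m-1}}=t_j+\dfrac{S_j}{\ell^{m-1}R_j^{m-1}}$ for all $i\in U$ and all $j\in W$. In addition, if the left equality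 holds and (i) fails, then $U,W,\ell$ in (ii) can be chosen with $\ell>1$; if the right equality holds and (i) fails, then they can be chosen with $\ell<1$. -/

import Mathlib

/-- A tensor of order `m` (meant for `m ≥ 1`) and dimension `n` with entries in `α`. The entry
`a_{i i_2 … i_m}` is `A i f`, where `f : Fin (m - 1) → Fin n` lists the indices `i_2, …, i_m`. -/
abbrev OrderTensor (α : Type*) (m n : ℕ) : Type _ :=
  Fin n → (Fin (m - 1) → Fin n) → α

namespace OrderTensor

/-- The vector `A X^{m-1}`, with components `∑_{i_2, …, i_m} a_{i i_2 … i_m} x_{i_2} ⋯ x_{i_m}`. -/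
def mulPow {α : Type*} [CommSemiring α] {m n : ℕ} (A : OrderTensor α m n) (x : Fin n → α) :
    Fin n → α :=
  fun i => ∑ f : Fin (m - 1) → Fin n, A i f * ∏ k, x (f k)

/-- `lam` is an eigenvalue of the complex tensor `A`: there is a nonzero complex vector `X` with
`A X^{m-1} = lam X^{[m-1]}`. -/
def IsEigenvalue {m n : ℕ} (A : OrderTensor ℂ m n) (lam : ℂ) : Prop :=
  ∃ x : Fin n → ℂ, x ≠ 0 ∧ ∀ i, A.mulPow x i = lam * x i ^ (m - 1)

/-- A real tensor, viewed as a complex one. -/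
def toComplex {m n : ℕ} (A : OrderTensor ℝ m n) : OrderTensor ℂ m n :=
  fun i f => (A i f : ℂ)

/-- The moduli of the (complex) eigenvalues of a real tensor. -/
def eigenvalueModuli {m n : ℕ} (A : OrderTensor ℝ m n) : Set ℝ :=
  {r | ∃ lam : ℂ, A.toComplex.IsEigenvalue lam ∧ r = ‖lam‖}

/-- The spectral radius: the largest modulus of an eigenvalue. -/
noncomputable def specRadius {m n : ℕ} (A : OrderTensor ℝ m n) : ℝ :=
  sSup A.eigenvalueModuli

/-- Weak reducibility: for some nonempty proper subset `I` of the index set, `a_{i_1 i_2 … i_m} = 0`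
whenever `i_1 ∈ I` and at least one of `i_2, …, i_m` is not in `I`. -/
def WeaklyReducible {m n : ℕ} (A : OrderTensor ℝ m n) : Prop :=
  ∃ I : Set (Fin n), I.Nonempty ∧ I ≠ Set.univ ∧
    ∀ i ∈ I, ∀ f : Fin (m - 1) → Fin n, (∃ k, f k ∉ I) → A i f = 0

/-- Weak irreducibility. -/
def WeaklyIrreducible {m n : ℕ} (A : OrderTensor ℝ m n) : Prop :=
  ¬ A.WeaklyReducible

/-- `N(i)`: the indices that occur among `i_2, …, i_m` for some nonzero entry
`a_{i i_2 … i_m}`. -/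
def nbhd {m n : ℕ} (A : OrderTensor ℝ m n) (i : Fin n) : Set (Fin n) :=
  {j | ∃ f : Fin (m - 1) → Fin n, A i f ≠ 0 ∧ ∃ k, f k = j}

/-- The diagonal tensor with diagonal entries `t_i`. -/
def diag (m : ℕ) {n : ℕ} (t : Fin n → ℝ) : OrderTensor ℝ m n :=
  fun i f => if ∀ k, f k = i then t i else 0

/-- `F(i,j) = (t_i + t_j + √((t_i - t_j)² + 4 S_i S_j / (R_i R_j)^{m-1})) / 2`, where
`S = A R^{m-1}`. -/
noncomputable def pairBound {m n : ℕ} (A : OrderTensor ℝ m n) (R t : Fin n → ℝ)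
    (i j : Fin n) : ℝ :=
  (t i + t j +
    Real.sqrt ((t i - t j) ^ 2 + 4 * A.mulPow R i * A.mulPow R j / (R i * R j) ^ (m - 1))) / 2

/-- The index set is the disjoint union of `U` and `W`, and `a_{i_1 i_2 … i_m} ≠ 0` only when
`i_1 ∈ U` and `i_2, …, i_m ∈ W`, or `i_1 ∈ W` and `i_2, …, i_m ∈ U`. -/
def IsBipartition {m n : ℕ} (A : OrderTensor ℝ m n) (U W : Set (Fin n)) : Prop :=
  U ∪ W = Set.univ ∧ U ∩ W = ∅ ∧
    ∀ (i : Fin n) (f : Fin (m - 1) → Fin n), A i f ≠ 0 →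
      (i ∈ U ∧ ∀ k, f k ∈ W) ∨ (i ∈ W ∧ ∀ k, f k ∈ U)

/-- `r = t_i + ℓ^{m-1} S_i / R_i^{m-1} = t_j + S_j / (ℓ^{m-1} R_j^{m-1})` for all `i ∈ U` and all
`j ∈ W`, where `S = A R^{m-1}`. -/
def ScaleRelation {m n : ℕ} (A : OrderTensor ℝ m n) (R t : Fin n → ℝ) (r : ℝ)
    (U W : Set (Fin n)) (l : ℝ) : Prop :=
  ∀ i ∈ U, ∀ j ∈ W,
    r = t i + l ^ (m - 1) * A.mulPow R i / R i ^ (m - 1) ∧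
    r = t j + A.mulPow R j / (l ^ (m - 1) * R j ^ (m - 1))

end OrderTensor

/-! Perron–Frobenius gives a positive `x` with `(r - t_i) x_i^{m-1} = (A x^{m-1})_i`, where `r` is
the spectral radius of `B`; in particular `r > t_i`. Put `k = m - 1`, `y = x / R`, `d_i = r - t_i`
and `s_i = S_i / R_i^k`. As `F(i,j)` is the larger root of `(z - t_i)(z - t_j) = s_i s_j`, comparing
`r` with `F(i,j)` amounts to comparing `d_i d_j` with `s_i s_j` (`le_pairBound_iff`,
`pairBound_le_iff`).

Monotonicity of `A` gives `d_i y_i^k ≤ s_i v^k` whenever `v` bounds `y` on `N(i)`, with equality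
exactly when `y = v` on `N(i)`. Multiply this inequality at a maximiser `p` of `y` by the one at an
index `q` of largest `y` in `N(p)`: the powers cancel and `d_p d_q ≤ s_p s_q`, which is the upper
bound. In the case of equality both factors are tight, and irreducibility spreads this: either `y`
is constant, which is (i), or `y` takes two values `M` and `l M` with `l < 1` on classes
interchanged by `N`, which is (ii). This is `exists_pair_and_rigidity`. The lower bound is the same
lemma with `d` and `s` exchanged and `y` replaced by `1/y`, so that `l` becomes `1/l`.

The eigenvector comes from minimising `max_i (B x^{m-1})_i / x_i^{m-1}` over positive `x`: a
minimiser with the fewest tight indices is tight everywhere, by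
`WeaklyIrreducible.exists_fewer_tight`. -/

namespace OrderTensor

/-! ### Extremal comparison along a neighbour relation -/

section Dominance

variable {ι : Type*} [Finite ι] [Nonempty ι]

/-- A pair of neighbours that compares `d` with `s`, together with the structure that is forced when
no pair of neighbours compares strictly the other way. -/
theorem exists_pair_and_rigidity (N : ι → Set ι)
    (hN : ∀ I : Set ι, I.Nonempty → (∀ i ∈ I, N i ⊆ I) → I = Set.univ)
    (hne : ∀ i, (N i).Nonempty) (d s y : ι → ℝ) (k : ℕ) (hk : k ≠ 0)
    (hd : ∀ i, 0 < d i) (hs : ∀ i, 0 < s i) (hy : ∀ i, 0 < y i)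
    (H : ∀ i v, 0 < v → (∀ j ∈ N i, y j ≤ v) → d i * y i ^ k ≤ s i * v ^ k ∧
      (d i * y i ^ k = s i * v ^ k ↔ ∀ j ∈ N i, y j = v)) :
    (∃ i, ∃ j ∈ N i, d i * d j ≤ s i * s j) ∧
    ((∀ i, ∀ j ∈ N i, s i * s j ≤ d i * d j) →
      (∀ i, d i = s i) ∨ ∃ (P : Set ι) (l : ℝ), 0 < l ∧ l < 1 ∧
        (∀ i ∈ P, N i ⊆ Pᶜ) ∧ (∀ i ∈ Pᶜ, N i ⊆ P) ∧
        (∀ i ∈ P, d i = l ^ k * s i) ∧ ∀ i ∈ Pᶜ, s i = l ^ k * d i) := by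
  classical
  obtain ⟨p₀, hp₀⟩ := Finite.exists_max y
  set M := y p₀ with hM
  have hM0 : 0 < M := hy p₀
  -- Use `H` at `p` with the largest neighbouring value and at `q` with the global bound `M`; the
  -- factors `M ^ k` and `y q ^ k` then cancel in the product.
  have hpair : ∀ p, y p = M → ∃ q ∈ N p, (∀ j ∈ N p, y j ≤ y q) ∧
      d p * M ^ k ≤ s p * y q ^ k ∧ d q * y q ^ k ≤ s q * M ^ k := by
    intro p hp
    obtain ⟨q, hq, hqm⟩ := Set.exists_max_image (N p) y (Set.toFinite _) (hne p)
    exact ⟨q, hq, hqm, hp ▸ (H p (y q) (hy q) hqm).1, (H q M hM0 fun j _ => hp₀ j).1⟩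
  have hmul : ∀ p q : ι, (d p * M ^ k) * (d q * y q ^ k) = (d p * d q) * (M ^ k * y q ^ k) ∧
      (s p * y q ^ k) * (s q * M ^ k) = (s p * s q) * (M ^ k * y q ^ k) := fun p q =>
    ⟨by ring, by ring⟩
  constructor
  · obtain ⟨q, hq, -, h1, h2⟩ := hpair p₀ rfl
    refine ⟨p₀, q, hq, ?_⟩
    have h := mul_le_mul h1 h2 (mul_pos (hd q) (pow_pos (hy q) k)).le
      (mul_pos (hs p₀) (pow_pos (hy q) k)).le
    rw [(hmul p₀ q).1, (hmul p₀ q).2] at h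
    exact le_of_mul_le_mul_right h (mul_pos (pow_pos hM0 k) (pow_pos (hy q) k))
  · intro hall
    -- Strictness in the first factor would give `d p * d q < s p * s q`, against `hall`.
    have htight : ∀ p, y p = M → ∃ v, 0 < v ∧ (∀ j ∈ N p, y j = v) ∧
        d p * M ^ k = s p * v ^ k := by
      intro p hp
      obtain ⟨q, hq, hqm, h1, h2⟩ := hpair p hp
      have heq : d p * M ^ k = s p * y q ^ k := by
        refine h1.eq_of_not_lt fun hlt => ?_
        have h := mul_lt_mul hlt h2 (mul_pos (hd q) (pow_pos (hy q) k))
          (mul_pos (hs p) (pow_pos (hy q) k)).le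
        rw [(hmul p q).1, (hmul p q).2] at h
        exact (lt_of_mul_lt_mul_right h
          (mul_pos (pow_pos hM0 k) (pow_pos (hy q) k)).le).not_ge (hall p q hq)
      exact ⟨y q, hy q, (H p (y q) (hy q) hqm).2.1 (hp.symm ▸ heq), heq⟩
    -- All neighbours of `p` share one value, so every `q ∈ N p` can serve as the maximal one.
    have hback : ∀ p, y p = M → ∀ q ∈ N p, (∀ j ∈ N q, y j = M) ∧
        d q * y q ^ k = s q * M ^ k := by
      intro p hp q hq
      obtain ⟨v, hv, hpv, h1⟩ := htight p hp
      have h2 := H q M hM0 fun j _ => hp₀ j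
      have heq : d q * y q ^ k = s q * M ^ k := by
        refine h2.1.eq_of_not_lt fun hlt => ?_
        have h := mul_lt_mul_of_pos_left hlt (mul_pos (hd p) (pow_pos hM0 k))
        rw [(hmul p q).1] at h
        rw [h1, ← hpv q hq, (hmul p q).2] at h
        exact (lt_of_mul_lt_mul_right h
          (mul_pos (pow_pos hM0 k) (pow_pos (hy q) k)).le).not_ge (hall p q hq)
      exact ⟨h2.2.1 heq, heq⟩
    choose! v hv hvN hvE using htight
    -- If one maximiser is a neighbour of another, the set of such indices is closed under `N` by
    -- `hback`, hence is everything.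
    by_cases hPQ : ∃ i, y i = M ∧ ∃ p, y p = M ∧ i ∈ N p
    · left
      obtain ⟨i₀, hi₀⟩ := hPQ
      have huniv := hN {i | y i = M ∧ ∃ p, y p = M ∧ i ∈ N p} ⟨i₀, hi₀⟩ (by
        rintro i ⟨hi, p, hp, hip⟩ j hj
        exact ⟨(hback p hp i hip).1 j hj, i, hi, hj⟩)
      have hconst : ∀ i, y i = M := fun i =>
        (huniv ▸ Set.mem_univ i : i ∈ {i | y i = M ∧ ∃ p, y p = M ∧ i ∈ N p}).1
      intro i
      have h := (H i M hM0 fun j _ => hp₀ j).2.2 fun j _ => hconst j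
      rw [hconst i] at h
      exact mul_right_cancel₀ (pow_pos hM0 k).ne' h
    · right
      have hdisj : ∀ p, y p = M → ∀ i ∈ N p, y i ≠ M := fun p hp i hi hiM =>
        hPQ ⟨i, hiM, p, hp, hi⟩
      have hcover : {i | y i = M ∨ ∃ p, y p = M ∧ i ∈ N p} = Set.univ := by
        refine hN _ ⟨p₀, Or.inl rfl⟩ ?_
        rintro i (hi | ⟨p, hp, hip⟩) j hj
        · exact Or.inr ⟨i, hi, hj⟩
        · exact Or.inl ((hback p hp i hip).1 j hj)
      have hQ : ∀ q, y q ≠ M → (∀ j ∈ N q, y j = M) ∧ d q * y q ^ k = s q * M ^ k := by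
        intro q hq
        obtain h | ⟨p, hp, hqp⟩ := (hcover ▸ Set.mem_univ q :
          q ∈ {i | y i = M ∨ ∃ p, y p = M ∧ i ∈ N p})
        · exact absurd h hq
        · exact hback p hp q hqp
      -- `N` need not be symmetric, so `q ∈ N p` is not available; `hall` on the pair `(q, p)`
      -- replaces it.
      have hmono : ∀ q, y q ≠ M → ∀ p ∈ N q, y q ≤ v p := by
        intro q hq p hpq
        have hp := (hQ q hq).1 p hpq
        have h : (s q * s p) * (M ^ k * y q ^ k) ≤ (s q * s p) * (M ^ k * v p ^ k) := by
          calc (s q * s p) * (M ^ k * y q ^ k) ≤ (d q * d p) * (M ^ k * y q ^ k) :=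
                mul_le_mul_of_nonneg_right (hall q p hpq)
                  (mul_pos (pow_pos hM0 k) (pow_pos (hy q) k)).le
            _ = (d q * y q ^ k) * (d p * M ^ k) := by ring
            _ = (s q * s p) * (M ^ k * v p ^ k) := by
                rw [(hQ q hq).2, hvE p hp]; ring
        have h' := le_of_mul_le_mul_left (le_of_mul_le_mul_left h (mul_pos (hs q) (hs p)))
          (pow_pos hM0 k)
        exact (pow_le_pow_iff_left₀ (hy q).le (hv p hp).le hk).1 h'
      have hQne : {q | y q ≠ M}.Nonempty := by
        obtain ⟨q, hq⟩ := hne p₀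
        exact ⟨q, hdisj p₀ rfl q hq⟩
      -- Neighbours of a maximiser `p` are not maximisers, so `v p ≤ y q₀`; with `hmono` the value
      -- `y q₀` propagates along `N`.
      obtain ⟨q₀, hq₀, hq₀max⟩ := Set.exists_max_image {q | y q ≠ M} y (Set.toFinite _) hQne
      have hconst : {i | (y i = M → v i = y q₀) ∧ (y i ≠ M → y i = y q₀)} = Set.univ := by
        refine hN _ ⟨q₀, fun h => absurd h hq₀, fun _ => rfl⟩ ?_
        rintro i ⟨hi1, hi2⟩ j hj
        by_cases hi : y i = M
        · refine ⟨fun h => absurd h (hdisj i hi j hj), fun _ => ?_⟩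
          rw [hvN i hi j hj, hi1 hi]
        · refine ⟨fun h => le_antisymm ?_ ?_, fun h => absurd ((hQ i hi).1 j hj) h⟩
          · obtain ⟨r, hr⟩ := hne j
            rw [← hvN j h r hr]
            exact hq₀max r (hdisj j h r hr)
          · rw [← hi2 hi]
            exact hmono i hi j hj
      have hc : ∀ i, (y i = M → v i = y q₀) ∧ (y i ≠ M → y i = y q₀) := fun i =>
        (hconst ▸ Set.mem_univ i : i ∈ {i | (y i = M → v i = y q₀) ∧ (y i ≠ M → y i = y q₀)})
      refine ⟨{i | y i = M}, y q₀ / M, div_pos (hy _) hM0,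
        (div_lt_one hM0).2 (lt_of_le_of_ne (hp₀ q₀) hq₀), fun i hi j hj => hdisj i hi j hj,
        fun i hi j hj => (hQ i hi).1 j hj, fun i hi => ?_, fun i hi => ?_⟩
      · have h := hvE i hi
        rw [(hc i).1 hi] at h
        rw [div_pow, div_mul_eq_mul_div, eq_div_iff (pow_pos hM0 k).ne', h, mul_comm]
      · have h := (hQ i hi).2
        rw [(hc i).2 hi] at h
        rw [div_pow, div_mul_eq_mul_div, eq_div_iff (pow_pos hM0 k).ne', ← h, mul_comm]

end Dominance

end OrderTensor

/-! ### Monotonicity of `A x^{m-1}` and neighbourhoods under weak irreducibility -/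

namespace OrderTensor

variable {m n : ℕ}

theorem mulPow_add_diag (A : OrderTensor ℝ m n) (t x : Fin n → ℝ) (i : Fin n) :
    (A + diag m t).mulPow x i = A.mulPow x i + t i * x i ^ (m - 1) := by
  have h : ∀ f : Fin (m - 1) → Fin n, (∀ k, f k = i) ↔ f = fun _ => i := fun f =>
    funext_iff.symm
  simp [mulPow, diag, add_mul, Finset.sum_add_distrib, h]

theorem mulPow_smul (A : OrderTensor ℝ m n) (c : ℝ) (x : Fin n → ℝ) (i : Fin n) :
    A.mulPow (fun j => c * x j) i = c ^ (m - 1) * A.mulPow x i := by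
  simp only [mulPow, Finset.prod_mul_distrib, Finset.mul_sum]
  refine Finset.sum_congr rfl fun f _ => ?_
  simp
  ring

theorem mulPow_congr (A : OrderTensor ℝ m n) {x y : Fin n → ℝ} {i : Fin n}
    (h : ∀ j ∈ A.nbhd i, x j = y j) : A.mulPow x i = A.mulPow y i := by
  refine Finset.sum_congr rfl fun f _ => ?_
  by_cases hf : A i f = 0
  · simp [hf]
  · rw [Finset.prod_congr rfl fun k _ => h (f k) ⟨f, hf, k, rfl⟩]

section Nonneg

variable {A : OrderTensor ℝ m n} (hA : ∀ i f, 0 ≤ A i f)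
include hA

theorem mulPow_mono {x y : Fin n → ℝ} (hx : ∀ j, 0 ≤ x j) {i : Fin n}
    (h : ∀ j ∈ A.nbhd i, x j ≤ y j) : A.mulPow x i ≤ A.mulPow y i := by
  refine Finset.sum_le_sum fun f _ => ?_
  by_cases hf : A i f = 0
  · simp [hf]
  · exact mul_le_mul_of_nonneg_left
      (Finset.prod_le_prod (fun k _ => hx _) fun k _ => h (f k) ⟨f, hf, k, rfl⟩) (hA i f)

theorem mulPow_strictMono {x y : Fin n → ℝ} (hx : ∀ j, 0 < x j) {i : Fin n}
    (h : ∀ j ∈ A.nbhd i, x j ≤ y j) (h' : ∃ j ∈ A.nbhd i, x j < y j) :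
    A.mulPow x i < A.mulPow y i := by
  obtain ⟨_, ⟨f, hf, k, rfl⟩, hlt⟩ := h'
  refine Finset.sum_lt_sum (fun g _ => ?_) ⟨f, Finset.mem_univ _, ?_⟩
  · by_cases hg : A i g = 0
    · simp [hg]
    · exact mul_le_mul_of_nonneg_left
        (Finset.prod_le_prod (fun k _ => (hx _).le) fun k _ => h (g k) ⟨g, hg, k, rfl⟩) (hA i g)
  · exact mul_lt_mul_of_pos_left
      (Finset.prod_lt_prod (fun k _ => hx _) (fun k _ => h (f k) ⟨f, hf, k, rfl⟩)
        ⟨k, Finset.mem_univ _, hlt⟩) (lt_of_le_of_ne (hA i f) (Ne.symm hf))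

theorem mulPow_nonneg {x : Fin n → ℝ} (hx : ∀ j, 0 ≤ x j) (i : Fin n) : 0 ≤ A.mulPow x i :=
  Finset.sum_nonneg fun f _ => mul_nonneg (hA i f) (Finset.prod_nonneg fun _ _ => hx _)

theorem entry_mul_prod_le_mulPow {x : Fin n → ℝ} (hx : ∀ j, 0 ≤ x j) (i : Fin n)
    (f : Fin (m - 1) → Fin n) : A i f * ∏ k, x (f k) ≤ A.mulPow x i :=
  Finset.single_le_sum (f := fun f => A i f * ∏ k, x (f k))
    (fun f _ => mul_nonneg (hA i f) (Finset.prod_nonneg fun _ _ => hx _)) (Finset.mem_univ f)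

theorem mulPow_pos {x : Fin n → ℝ} (hx : ∀ j, 0 < x j) {i : Fin n}
    (hi : (A.nbhd i).Nonempty) : 0 < A.mulPow x i := by
  obtain ⟨_, f, hf, -⟩ := hi
  exact (mul_pos (lt_of_le_of_ne (hA i f) (Ne.symm hf))
    (Finset.prod_pos fun k _ => hx _)).trans_le
    (entry_mul_prod_le_mulPow hA (fun j => (hx j).le) i f)

end Nonneg

theorem WeaklyIrreducible.eq_univ {A : OrderTensor ℝ m n} (hA : A.WeaklyIrreducible)
    (I : Set (Fin n)) (hI : I.Nonempty) (h : ∀ i ∈ I, A.nbhd i ⊆ I) : I = Set.univ := by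
  by_contra hne
  refine hA ⟨I, hI, hne, fun i hi f ⟨k, hk⟩ => ?_⟩
  by_contra hf
  exact hk (h i hi ⟨f, hf, k, rfl⟩)

theorem WeaklyIrreducible.nbhd_nonempty {A : OrderTensor ℝ m n} (hA : A.WeaklyIrreducible)
    (hn : 2 ≤ n) (i : Fin n) : (A.nbhd i).Nonempty := by
  by_contra hne
  rw [Set.not_nonempty_iff_eq_empty] at hne
  have h := hA.eq_univ {i} ⟨i, rfl⟩ (by rintro _ rfl; simp [hne])
  have : Nontrivial (Fin n) := Fin.nontrivial_iff_two_le.2 hn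
  obtain ⟨j, hj⟩ := exists_ne i
  exact hj (h ▸ Set.mem_univ j : j ∈ ({i} : Set (Fin n)))

theorem WeaklyIrreducible.add_diag {A : OrderTensor ℝ m n} (hA : A.WeaklyIrreducible)
    (t : Fin n → ℝ) : (A + diag m t).WeaklyIrreducible := by
  rintro ⟨I, hI, hne, h⟩
  refine hA ⟨I, hI, hne, fun i hi f hf => ?_⟩
  have h0 := h i hi f hf
  obtain ⟨k, hk⟩ := hf
  have : ¬ ∀ k, f k = i := fun hall => hk (hall k ▸ hi)
  simpa [diag, this] using h0

/-! ### Perron–Frobenius theory for weakly irreducible nonnegative tensors -/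

section Spectrum

variable {B : OrderTensor ℝ m n} (hB : ∀ i f, 0 ≤ B i f)
include hB

/-- Vectors `x ≥ 1` with some entry `1` and `B x^{m-1} ≤ c x^{[m-1]}` are uniformly bounded. -/
theorem WeaklyIrreducible.exists_bound (hirr : B.WeaklyIrreducible) {c : ℝ} (hc : 0 ≤ c) :
    ∃ C : ℝ, ∀ x : Fin n → ℝ, (∀ i, 1 ≤ x i) → (∃ i, x i = 1) →
      (∀ i, B.mulPow x i ≤ c * x i ^ (m - 1)) → ∀ j, x j ≤ C := by
  have key : ∀ i₀ j : Fin n, ∃ C : ℝ, ∀ x : Fin n → ℝ, (∀ i, 1 ≤ x i) → x i₀ = 1 →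
      (∀ i, B.mulPow x i ≤ c * x i ^ (m - 1)) → x j ≤ C := by
    intro i₀ j
    -- Boundedness passes from `i` to its neighbours: in a nonzero term of row `i` the other factors
    -- are at least `1`.
    have h := hirr.eq_univ {j | ∃ C : ℝ, ∀ x : Fin n → ℝ, (∀ i, 1 ≤ x i) → x i₀ = 1 →
      (∀ i, B.mulPow x i ≤ c * x i ^ (m - 1)) → x j ≤ C}
      ⟨i₀, 1, fun x _ h _ => h.le⟩ (by
        rintro i ⟨C, hC⟩ _ ⟨f, hf, k, rfl⟩
        refine ⟨c * C ^ (m - 1) / B i f, fun x hx1 hx0 hx => ?_⟩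
        have hpos : 0 < B i f := lt_of_le_of_ne (hB i f) (Ne.symm hf)
        have hx0' : ∀ j, 0 ≤ x j := fun j => zero_le_one.trans (hx1 j)
        rw [le_div_iff₀ hpos, mul_comm]
        calc B i f * x (f k) ≤ B i f * ∏ k, x (f k) := by
              refine mul_le_mul_of_nonneg_left ?_ hpos.le
              rw [← Finset.mul_prod_erase _ _ (Finset.mem_univ k)]
              exact le_mul_of_one_le_right (hx0' _) (Finset.one_le_prod fun j _ => hx1 _)
          _ ≤ B.mulPow x i := entry_mul_prod_le_mulPow hB hx0' i f
          _ ≤ c * x i ^ (m - 1) := hx i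
          _ ≤ c * C ^ (m - 1) :=
              mul_le_mul_of_nonneg_left (pow_le_pow_left₀ (hx0' i) (hC x hx1 hx0 hx) _) hc)
    exact (h ▸ Set.mem_univ j : j ∈ {j | ∃ C : ℝ, ∀ x : Fin n → ℝ, (∀ i, 1 ≤ x i) → x i₀ = 1 →
      (∀ i, B.mulPow x i ≤ c * x i ^ (m - 1)) → x j ≤ C})
  choose C hC using key
  obtain ⟨D, hD⟩ := (Set.finite_range fun p : Fin n × Fin n => C p.1 p.2).bddAbove
  exact ⟨D, fun x h1 ⟨i₀, h0⟩ hx j =>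
    (hC i₀ j x h1 h0 hx).trans (hD ⟨(i₀, j), rfl⟩)⟩

omit hB in
theorem continuous_mulPow (B : OrderTensor ℝ m n) (i : Fin n) :
    Continuous fun x : Fin n → ℝ => B.mulPow x i := by
  unfold mulPow
  fun_prop

/-- The Collatz–Wielandt minimum is attained at a positive vector. -/
theorem WeaklyIrreducible.exists_collatzWielandt (hirr : B.WeaklyIrreducible) [NeZero n] :
    ∃ r : ℝ, 0 ≤ r ∧ (∃ x : Fin n → ℝ, (∀ i, 0 < x i) ∧ ∀ i, B.mulPow x i ≤ r * x i ^ (m - 1)) ∧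
      ∀ x : Fin n → ℝ, (∀ i, 0 < x i) → ∃ i, r * x i ^ (m - 1) ≤ B.mulPow x i := by
  have hU : (Finset.univ : Finset (Fin n)).Nonempty := Finset.univ_nonempty
  let φ : (Fin n → ℝ) → ℝ := fun x =>
    Finset.univ.sup' hU fun i => B.mulPow x i / x i ^ (m - 1)
  have hφle : ∀ x : Fin n → ℝ, (∀ i, 0 < x i) → ∀ i, B.mulPow x i ≤ φ x * x i ^ (m - 1) :=
    fun x hx i => (div_le_iff₀ (pow_pos (hx i) _)).1
      (Finset.le_sup' (fun i => B.mulPow x i / x i ^ (m - 1)) (Finset.mem_univ i))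
  have hφ0 : ∀ x : Fin n → ℝ, (∀ i, 0 < x i) → 0 ≤ φ x := fun x hx =>
    (div_nonneg (mulPow_nonneg hB (fun j => (hx j).le) 0) (pow_pos (hx 0) _).le).trans
      (Finset.le_sup' (fun i => B.mulPow x i / x i ^ (m - 1)) (Finset.mem_univ 0))
  -- A competitor with `φ ≤ φ 1`, scaled to have smallest entry `1`, lies in the box `[1, max C 1]`;
  -- the maximum with `1` keeps the all-ones vector in it.
  obtain ⟨C, hC⟩ := hirr.exists_bound hB (hφ0 1 fun _ => one_pos)
  have hcont : ContinuousOn φ (Set.Icc 1 fun _ => max C 1) := by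
    refine ContinuousOn.finset_sup'_apply hU fun i _ => ?_
    refine (continuous_mulPow B i).continuousOn.div (by fun_prop) fun x hx => ?_
    exact (pow_pos (zero_lt_one.trans_le (hx.1 i)) _).ne'
  obtain ⟨z, hz, hzmin⟩ := isCompact_Icc.exists_isMinOn
    (⟨1, le_rfl, fun _ => le_max_right _ _⟩ :
      (Set.Icc (1 : Fin n → ℝ) fun _ => max C 1).Nonempty) hcont
  have hzpos : ∀ i, 0 < z i := fun i => zero_lt_one.trans_le (hz.1 i)
  refine ⟨φ z, hφ0 z hzpos, ⟨z, hzpos, hφle z hzpos⟩, fun x hx => ?_⟩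
  by_contra! hlt
  obtain ⟨p, hp⟩ := Finite.exists_min x
  set w : Fin n → ℝ := fun j => (x p)⁻¹ * x j with hw
  have hwpos : ∀ i, 0 < w i := fun i => mul_pos (inv_pos.2 (hx p)) (hx i)
  have hwlt : ∀ i, B.mulPow w i < φ z * w i ^ (m - 1) := by
    intro i
    rw [hw, mulPow_smul, mul_pow, mul_left_comm]
    exact mul_lt_mul_of_pos_left (hlt i) (pow_pos (inv_pos.2 (hx p)) _)
  have hw1 : ∀ i, 1 ≤ w i := fun i => by
    rw [hw, ← inv_mul_cancel₀ (hx p).ne']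
    exact mul_le_mul_of_nonneg_left (hp i) (inv_pos.2 (hx p)).le
  have hz1 : φ z ≤ φ 1 := hzmin ⟨le_rfl, fun _ => le_max_right _ _⟩
  have hwC := hC w hw1 ⟨p, inv_mul_cancel₀ (hx p).ne'⟩ fun i =>
    (hwlt i).le.trans (mul_le_mul_of_nonneg_right hz1 (pow_pos (hwpos i) _).le)
  have hzw : φ z ≤ φ w := hzmin ⟨hw1, fun i => (hwC i).trans (le_max_left _ _)⟩
  refine hzw.not_gt ((Finset.sup'_lt_iff hU).2 fun i _ => ?_)
  exact (div_lt_iff₀ (pow_pos (hwpos i) _)).2 (hwlt i)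

/-- Shrinking the entries outside the tight set makes another index slack. -/
theorem WeaklyIrreducible.exists_fewer_tight (hirr : B.WeaklyIrreducible) {r : ℝ}
    {x : Fin n → ℝ} (hx : ∀ i, 0 < x i) (hle : ∀ i, B.mulPow x i ≤ r * x i ^ (m - 1))
    (hne : {i | B.mulPow x i = r * x i ^ (m - 1)}.Nonempty)
    (huniv : {i | B.mulPow x i = r * x i ^ (m - 1)} ≠ Set.univ) :
    ∃ y : Fin n → ℝ, (∀ i, 0 < y i) ∧ (∀ i, B.mulPow y i ≤ r * y i ^ (m - 1)) ∧
      {i | B.mulPow y i = r * y i ^ (m - 1)} ⊂ {i | B.mulPow x i = r * x i ^ (m - 1)} := by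
  classical
  set I := {i | B.mulPow x i = r * x i ^ (m - 1)} with hI
  let y : ℝ → Fin n → ℝ := fun c j => if j ∈ I then x j else c * x j
  have hy1 : y 1 = x := by
    funext j
    simp [y]
  have hycont : Continuous y := by
    refine continuous_pi fun j => ?_
    by_cases hj : j ∈ I
    · simpa [y, hj] using continuous_const
    · simp only [y, hj, if_false]
      fun_prop
  have hev : ∀ᶠ c in nhds (1 : ℝ), ∀ i, i ∉ I → B.mulPow (y c) i < r * y c i ^ (m - 1) := by
    rw [Filter.eventually_all]
    intro i
    by_cases hi : i ∈ I
    · exact Filter.Eventually.of_forall fun _ h => absurd hi h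
    · have hlt : B.mulPow (y 1) i < r * y 1 i ^ (m - 1) := by
        rw [hy1]
        exact lt_of_le_of_ne (hle i) hi
      have h1 : Continuous fun c => B.mulPow (y c) i := (continuous_mulPow B i).comp hycont
      have h2 : Continuous fun c => r * y c i ^ (m - 1) :=
        continuous_const.mul (((continuous_apply i).comp hycont).pow _)
      exact (h1.continuousAt.eventually_lt h2.continuousAt hlt).mono fun _ h _ => h
  -- Take `c < 1` so close to `1` that the slack indices stay slack.
  obtain ⟨c, ⟨hc, hc0⟩, hc1⟩ := (((hev.and (lt_mem_nhds one_pos)).filter_mono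
    nhdsWithin_le_nhds).and (self_mem_nhdsWithin : Set.Iio (1 : ℝ) ∈ nhdsWithin 1 (Set.Iio 1))).exists
  have hypos : ∀ j, 0 < y c j := fun j => by
    by_cases hj : j ∈ I
    · simpa [y, hj] using hx j
    · simpa [y, hj] using mul_pos hc0 (hx j)
  have hylt : ∀ j, j ∉ I → y c j < x j := fun j hj => by
    simpa [y, hj] using mul_lt_of_lt_one_left (hx j) hc1
  have hyI : ∀ j ∈ I, y c j = x j := fun j hj => by simp [y, hj]
  have hyle : ∀ j, y c j ≤ x j := fun j => by
    by_cases hj : j ∈ I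
    · exact (hyI j hj).le
    · exact (hylt j hj).le
  have hIle : ∀ i ∈ I, B.mulPow (y c) i ≤ r * y c i ^ (m - 1) := fun i hi => by
    rw [hyI i hi]
    exact (mulPow_mono hB (fun j => (hypos j).le) fun j _ => hyle j).trans (hle i)
  refine ⟨y c, hypos, fun i => ?_, ?_⟩
  · by_cases hi : i ∈ I
    · exact hIle i hi
    · exact (hc i hi).le
  · have hsub : {i | B.mulPow (y c) i = r * y c i ^ (m - 1)} ⊆ I := fun i hi => by
      by_contra hiI
      exact (hc i hiI).ne hi
    refine ⟨hsub, fun hsup => huniv (hirr.eq_univ I hne fun i hi j hj => ?_)⟩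
    by_contra hjI
    have hstrict : B.mulPow (y c) i < B.mulPow x i :=
      mulPow_strictMono hB hypos (fun j _ => hyle j) ⟨j, hj, hylt j hjI⟩
    have h1 : B.mulPow (y c) i = r * y c i ^ (m - 1) := hsup hi
    rw [hyI i hi] at h1
    exact hstrict.ne (h1.trans (Eq.symm hi))

/-- Perron–Frobenius: a weakly irreducible nonnegative tensor has a positive eigenvector. -/
theorem WeaklyIrreducible.exists_pos_eigenvector (hirr : B.WeaklyIrreducible) [NeZero n] :
    ∃ (r : ℝ) (x : Fin n → ℝ), 0 ≤ r ∧ (∀ i, 0 < x i) ∧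
      ∀ i, B.mulPow x i = r * x i ^ (m - 1) := by
  obtain ⟨r, hr, ⟨x₀, hx₀, hle₀⟩, hmin⟩ := hirr.exists_collatzWielandt hB
  have hex : ∃ (N : ℕ) (x : Fin n → ℝ), (∀ i, 0 < x i) ∧
      (∀ i, B.mulPow x i ≤ r * x i ^ (m - 1)) ∧
      {i | B.mulPow x i = r * x i ^ (m - 1)}.ncard = N := ⟨_, x₀, hx₀, hle₀, rfl⟩
  classical
  -- `x` has the fewest tight indices; `hmin` guarantees at least one.
  obtain ⟨x, hx, hle, hcard⟩ := Nat.find_spec hex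
  refine ⟨r, x, hr, hx, ?_⟩
  by_contra hall
  have huniv : {i | B.mulPow x i = r * x i ^ (m - 1)} ≠ Set.univ := fun h =>
    hall fun i => (h ▸ Set.mem_univ i : i ∈ {i | B.mulPow x i = r * x i ^ (m - 1)})
  obtain ⟨i, hi⟩ := hmin x hx
  obtain ⟨y, hy, hyle, hss⟩ := hirr.exists_fewer_tight hB hx hle
    ⟨i, le_antisymm (hle i) hi⟩ huniv
  exact Nat.find_min hex (hcard ▸ Set.ncard_lt_ncard hss (Set.toFinite _)) ⟨y, hy, hyle, rfl⟩

/-- The eigenvalue of a positive eigenvector is the largest modulus of an eigenvalue. -/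
theorem isGreatest_eigenvalueModuli [NeZero n] {r : ℝ} (hr : 0 ≤ r) {x : Fin n → ℝ}
    (hx : ∀ i, 0 < x i) (h : ∀ i, B.mulPow x i = r * x i ^ (m - 1)) :
    IsGreatest B.eigenvalueModuli r := by
  constructor
  · refine ⟨r, ⟨fun i => x i, fun h0 => ?_, fun i => ?_⟩, ?_⟩
    · exact (hx 0).ne' (by simpa using congrFun h0 0)
    · have := congrArg (fun z : ℝ => (z : ℂ)) (h i)
      simpa [mulPow, toComplex] using this
    · simp [abs_of_nonneg hr]
  · rintro _ ⟨lam, ⟨z, hz, hlam⟩, rfl⟩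
    -- With `c` the largest ratio, `c * x` dominates `‖z‖` and touches it at `p`, where the two
    -- eigenvalue equations are compared.
    obtain ⟨p, hp⟩ := Finite.exists_max fun i => ‖z i‖ / x i
    set c := ‖z p‖ / x p with hc
    have hle : ∀ j, ‖z j‖ ≤ c * x j := fun j => (div_le_iff₀ (hx j)).1 (hp j)
    have hzp : ‖z p‖ = c * x p := (div_mul_cancel₀ _ (hx p).ne').symm
    have hcpos : 0 < c := by
      obtain ⟨j, hj⟩ := Function.ne_iff.1 hz
      exact (div_pos (norm_pos_iff.2 hj) (hx j)).trans_le (hp j)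
    have hzp0 : 0 < ‖z p‖ ^ (m - 1) := pow_pos (hzp ▸ mul_pos hcpos (hx p)) _
    refine le_of_mul_le_mul_right ?_ hzp0
    calc ‖lam‖ * ‖z p‖ ^ (m - 1) = ‖B.toComplex.mulPow z p‖ := by rw [hlam p]; simp
      _ ≤ B.mulPow (fun j => ‖z j‖) p := by
          refine (norm_sum_le _ _).trans_eq (Finset.sum_congr rfl fun f _ => ?_)
          simp [toComplex, abs_of_nonneg (hB p f)]
      _ ≤ B.mulPow (fun j => c * x j) p :=
          mulPow_mono hB (fun j => norm_nonneg _) fun j _ => hle j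
      _ = r * ‖z p‖ ^ (m - 1) := by rw [mulPow_smul, h p, hzp]; ring

end Spectrum

end OrderTensor

/-! ### Pair bounds as roots of quadratics -/

namespace OrderTensor

variable {m n : ℕ}

section PairBound

variable {A : OrderTensor ℝ m n} {R t : Fin n → ℝ} {z : ℝ} {i j : Fin n}

theorem pairBound_eq (A : OrderTensor ℝ m n) (R t : Fin n → ℝ) (i j : Fin n) :
    A.pairBound R t i j = (t i + t j + Real.sqrt ((t i - t j) ^ 2 +
      4 * (A.mulPow R i / R i ^ (m - 1) * (A.mulPow R j / R j ^ (m - 1))))) / 2 := by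
  rw [pairBound, mul_pow, div_mul_div_comm, mul_assoc, mul_div_assoc]

/-- `F(i,j)` is the larger root of a quadratic in `z`. Above both `t i` and `t j` the number `2 z -
t i - t j` is positive, so the square root can be squared away. -/
theorem le_pairBound_iff (hi : t i < z) (hj : t j < z) :
    z ≤ A.pairBound R t i j ↔ (z - t i) * (z - t j) ≤
      A.mulPow R i / R i ^ (m - 1) * (A.mulPow R j / R j ^ (m - 1)) := by
  rw [pairBound_eq, le_div_iff₀ two_pos, ← sub_le_iff_le_add', Real.le_sqrt' (by linarith)]
  constructor <;> intro h <;> linarith [h]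

theorem pairBound_le_iff (hi : t i < z) (hj : t j < z) :
    A.pairBound R t i j ≤ z ↔ A.mulPow R i / R i ^ (m - 1) * (A.mulPow R j / R j ^ (m - 1)) ≤
      (z - t i) * (z - t j) := by
  rw [pairBound_eq, div_le_iff₀ two_pos, ← le_sub_iff_add_le', Real.sqrt_le_left (by linarith)]
  constructor <;> intro h <;> linarith [h]

end PairBound

/-- Reduces the comparison of `d_i y_i^k` with `s_i v^k` to that of `A` at `x` with `A` at `v R`,
where monotonicity applies. -/
theorem sub_mul_div_pow_and_div_mul_pow {A : OrderTensor ℝ m n} {R t x : Fin n → ℝ} {r : ℝ}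
    (h : ∀ i, A.mulPow x i + t i * x i ^ (m - 1) = r * x i ^ (m - 1)) (i : Fin n) (v : ℝ) :
    (r - t i) * (x i / R i) ^ (m - 1) = A.mulPow x i / R i ^ (m - 1) ∧
    A.mulPow R i / R i ^ (m - 1) * v ^ (m - 1) =
      A.mulPow (fun j => v * R j) i / R i ^ (m - 1) := by
  constructor
  · rw [eq_sub_of_add_eq (h i), div_pow]
    ring
  · rw [mulPow_smul]
    ring

/-- A bipartition with a scaling relation makes every pair bound equal to `r`. -/
theorem pairBound_eq_of_scaleRelation {A : OrderTensor ℝ m n} {R t : Fin n → ℝ} {r l : ℝ}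
    {U W : Set (Fin n)} (hl : 0 < l) (ht : ∀ i, t i < r) (hUW : A.IsBipartition U W)
    (h : A.ScaleRelation R t r U W l) {i j : Fin n} (hij : j ∈ A.nbhd i) :
    A.pairBound R t i j = r := by
  have key : ∀ u ∈ U, ∀ w ∈ W, (r - t u) * (r - t w) =
      A.mulPow R u / R u ^ (m - 1) * (A.mulPow R w / R w ^ (m - 1)) := by
    intro u hu w hw
    obtain ⟨h1, h2⟩ := h u hu w hw
    have hl' : l ^ (m - 1) ≠ 0 := (pow_pos hl _).ne'
    rw [sub_eq_of_eq_add' h1, sub_eq_of_eq_add' h2, mul_div_assoc, ← div_div, div_right_comm]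
    field_simp
  have hprod : (r - t i) * (r - t j) =
      A.mulPow R i / R i ^ (m - 1) * (A.mulPow R j / R j ^ (m - 1)) := by
    obtain ⟨f, hf, k, rfl⟩ := hij
    obtain ⟨hi, hf'⟩ | ⟨hi, hf'⟩ := hUW.2.2 i f hf
    · exact key i hi _ (hf' k)
    · rw [mul_comm, key _ (hf' k) i hi, mul_comm]
  exact le_antisymm ((pairBound_le_iff (ht i) (ht j)).2 hprod.ge)
    ((le_pairBound_iff (ht i) (ht j)).2 hprod.le)

theorem isBipartition_compl {A : OrderTensor ℝ m n} {P : Set (Fin n)}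
    (h1 : ∀ i ∈ P, A.nbhd i ⊆ Pᶜ) (h2 : ∀ i ∈ Pᶜ, A.nbhd i ⊆ P) : A.IsBipartition P Pᶜ := by
  refine ⟨Set.union_compl_self P, Set.inter_compl_self P, fun i f hf => ?_⟩
  by_cases hi : i ∈ P
  · exact Or.inl ⟨hi, fun k => h1 i hi ⟨f, hf, k, rfl⟩⟩
  · exact Or.inr ⟨hi, fun k => h2 i hi ⟨f, hf, k, rfl⟩⟩

end OrderTensor

/-! ### The two bounds and their equality cases -/

open OrderTensor in
theorem theorem2p3 (m n : ℕ) (hm : 2 ≤ m) (hn : 2 ≤ n)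
    (A : OrderTensor ℝ m n)
    (hA_nonneg : ∀ i f, 0 ≤ A i f)
    (hA_irred : A.WeaklyIrreducible)
    (hA_diag : ∀ i, A i (fun _ => i) = 0)
    (R : Fin n → ℝ) (hR : ∀ i, 0 < R i)
    (t : Fin n → ℝ) (ht : ∀ i, 0 ≤ t i)
    (S : Fin n → ℝ) (hS : S = A.mulPow R)
    (B : OrderTensor ℝ m n) (hB : B = A + OrderTensor.diag m t) :
    -- the spectral radius is an attained maximum
    IsGreatest B.eigenvalueModuli B.specRadius ∧
    ∃ lo hi : ℝ,
      IsLeast {x | ∃ i j, j ∈ A.nbhd i ∧ x = A.pairBound R t i j} lo ∧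
      IsGreatest {x | ∃ i j, j ∈ A.nbhd i ∧ x = A.pairBound R t i j} hi ∧
      -- the two bounds
      lo ≤ B.specRadius ∧ B.specRadius ≤ hi ∧
      -- equality on the left
      (lo = B.specRadius ↔
        (∀ i j, t i + S i / R i ^ (m - 1) = t j + S j / R j ^ (m - 1)) ∨
        ∃ U W : Set (Fin n), A.IsBipartition U W ∧
          ∃ l : ℝ, 0 < l ∧ A.ScaleRelation R t B.specRadius U W l) ∧
      -- equality on the right
      (B.specRadius = hi ↔
        (∀ i j, t i + S i / R i ^ (m - 1) = t j + S j / R j ^ (m - 1)) ∨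
        ∃ U W : Set (Fin n), A.IsBipartition U W ∧
          ∃ l : ℝ, 0 < l ∧ A.ScaleRelation R t B.specRadius U W l) ∧
      -- the position of the scaling factor relative to 1
      (lo = B.specRadius →
        (∀ i j, t i + S i / R i ^ (m - 1) = t j + S j / R j ^ (m - 1)) ∨
        ∃ U W : Set (Fin n), A.IsBipartition U W ∧
          ∃ l : ℝ, 1 < l ∧ A.ScaleRelation R t B.specRadius U W l) ∧
      (B.specRadius = hi →
        (∀ i j, t i + S i / R i ^ (m - 1) = t j + S j / R j ^ (m - 1)) ∨
        ∃ U W : Set (Fin n), A.IsBipartition U W ∧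
          ∃ l : ℝ, 0 < l ∧ l < 1 ∧ A.ScaleRelation R t B.specRadius U W l) := by
  have : NeZero n := ⟨by omega⟩
  have hk : m - 1 ≠ 0 := by omega
  subst hS
  have hBnn : ∀ i f, 0 ≤ B i f := fun i f => by
    rw [hB]
    refine add_nonneg (hA_nonneg i f) ?_
    unfold diag
    split_ifs
    exacts [ht i, le_rfl]
  have hBirr : B.WeaklyIrreducible := hB ▸ hA_irred.add_diag t
  obtain ⟨r, x, hr, hx, hBx⟩ := hBirr.exists_pos_eigenvector hBnn
  have hgreat := isGreatest_eigenvalueModuli hBnn hr hx hBx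
  have hrad : B.specRadius = r := hgreat.csSup_eq
  rw [hrad]
  have heig : ∀ i, A.mulPow x i + t i * x i ^ (m - 1) = r * x i ^ (m - 1) := fun i => by
    rw [← mulPow_add_diag, ← hB, hBx]
  have hne := hA_irred.nbhd_nonempty hn
  have hRk : ∀ i, 0 < R i ^ (m - 1) := fun i => pow_pos (hR i) _
  have htr : ∀ i, t i < r := fun i => by
    have h := mulPow_pos hA_nonneg hx (hne i)
    exact lt_of_mul_lt_mul_right (by linarith [heig i]) (pow_pos (hx i) (m - 1)).le
  set s : Fin n → ℝ := fun i => A.mulPow R i / R i ^ (m - 1) with hs_def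
  have hs : ∀ i, 0 < s i := fun i => div_pos (mulPow_pos hA_nonneg hR (hne i)) (hRk i)
  have hd : ∀ i, 0 < r - t i := fun i => sub_pos.2 (htr i)
  have hy : ∀ i, 0 < x i / R i := fun i => div_pos (hx i) (hR i)
  have hup := exists_pair_and_rigidity A.nbhd hA_irred.eq_univ hne (fun i => r - t i) s
    (fun i => x i / R i) (m - 1) hk hd hs hy (by
      intro i v hv hle
      have hle' : ∀ j ∈ A.nbhd i, x j ≤ v * R j := fun j hj => (div_le_iff₀ (hR j)).1 (hle j hj)
      rw [(sub_mul_div_pow_and_div_mul_pow heig i v).1, (sub_mul_div_pow_and_div_mul_pow heig i v).2,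
        div_le_div_iff_of_pos_right (hRk i), div_left_inj' (hRk i).ne']
      refine ⟨mulPow_mono hA_nonneg (fun j => (hx j).le) hle', fun h j hj => ?_, fun h =>
        mulPow_congr A fun j hj => (div_eq_iff (hR j).ne').1 (h j hj)⟩
      refine (hle j hj).eq_of_not_lt fun hlt => ?_
      exact (mulPow_strictMono hA_nonneg hx hle' ⟨j, hj, (div_lt_iff₀ (hR j)).1 hlt⟩).ne h)
  have hlow := exists_pair_and_rigidity A.nbhd hA_irred.eq_univ hne s (fun i => r - t i)
    (fun i => (x i / R i)⁻¹) (m - 1) hk hs hd (fun i => inv_pos.2 (hy i)) (by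
      intro i v hv hle
      have hle' : ∀ j ∈ A.nbhd i, v⁻¹ * R j ≤ x j := fun j hj =>
        (le_div_iff₀ (hR j)).1 ((inv_le_comm₀ (hy j) hv).1 (hle j hj))
      have hyk := pow_pos (hy i) (m - 1)
      have hvk := pow_pos hv (m - 1)
      -- Extracting the common factor `(v / y_i)^k` turns the reciprocal inequality into `A` at `v⁻¹
      -- R` against `A` at `x`.
      have e : s i * (x i / R i)⁻¹ ^ (m - 1) = (s i * v⁻¹ ^ (m - 1)) *
            (v ^ (m - 1) * ((x i / R i) ^ (m - 1))⁻¹) ∧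
          (r - t i) * v ^ (m - 1) = ((r - t i) * (x i / R i) ^ (m - 1)) *
            (v ^ (m - 1) * ((x i / R i) ^ (m - 1))⁻¹) := by
        rw [inv_pow, inv_pow]
        generalize (x i / R i) ^ (m - 1) = a at *
        generalize v ^ (m - 1) = b at *
        constructor <;> field_simp
      have hfac := mul_pos hvk (inv_pos.2 hyk)
      rw [e.1, e.2, mul_le_mul_iff_left₀ hfac, mul_left_inj' hfac.ne',
        (sub_mul_div_pow_and_div_mul_pow heig i v⁻¹).1, (sub_mul_div_pow_and_div_mul_pow heig i v⁻¹).2,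
        div_le_div_iff_of_pos_right (hRk i), div_left_inj' (hRk i).ne']
      have hvR : ∀ j, 0 < v⁻¹ * R j := fun j => mul_pos (inv_pos.2 hv) (hR j)
      refine ⟨mulPow_mono hA_nonneg (fun j => (hvR j).le) hle', fun h j hj => ?_, fun h =>
        mulPow_congr A fun j hj => ?_⟩
      · refine (hle j hj).eq_of_not_lt fun hlt => ?_
        exact (mulPow_strictMono hA_nonneg hvR hle'
          ⟨j, hj, (lt_div_iff₀ (hR j)).1 ((inv_lt_comm₀ (hy j) hv).1 hlt)⟩).ne h
      · rw [← h j hj, inv_inv, div_mul_cancel₀ _ (hR j).ne'])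
  set E := {z | ∃ i j, j ∈ A.nbhd i ∧ z = A.pairBound R t i j} with hE
  have hEfin : E.Finite := by
    refine (Set.finite_range fun p : Fin n × Fin n => A.pairBound R t p.1 p.2).subset ?_
    rintro _ ⟨i, j, -, rfl⟩
    exact ⟨(i, j), rfl⟩
  have hEne : E.Nonempty := by
    obtain ⟨j, hj⟩ := hne 0
    exact ⟨_, 0, j, hj, rfl⟩
  obtain ⟨lo, hlo⟩ := hEfin.exists_minimal hEne |>.imp fun a ha =>
    (⟨ha.1, fun b hb => (le_total a b).elim id fun h => ha.2 hb h⟩ : IsLeast E a)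
  obtain ⟨hi, hhi⟩ := hEfin.exists_maximal hEne |>.imp fun a ha =>
    (⟨ha.1, fun b hb => (le_total b a).elim id fun h => ha.2 hb h⟩ : IsGreatest E a)
  have hconst : (∀ i, r - t i = s i) → ∀ i j, t i + s i = t j + s j := fun h i j => by
    rw [← h i, ← h j]
    ring
  -- equality on either side forces the structure, with the position of the scaling factor
  have hleft : lo = r → (∀ i j, t i + s i = t j + s j) ∨
      ∃ U W : Set (Fin n), A.IsBipartition U W ∧
        ∃ l : ℝ, 1 < l ∧ A.ScaleRelation R t r U W l := by
    intro h
    obtain h1 | ⟨P, l, hl0, hl1, hP, hP', hd1, hd2⟩ := hlow.2 fun i j hj =>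
      (le_pairBound_iff (htr i) (htr j)).1 (h ▸ hlo.2 ⟨i, j, hj, rfl⟩)
    · exact Or.inl (hconst fun i => (h1 i).symm)
    -- With `d` and `s` exchanged, rigidity gives `s = l^k d` on `P`, so the scaling factor is `l⁻¹
    -- > 1`.
    · refine Or.inr ⟨P, Pᶜ, isBipartition_compl hP hP', l⁻¹, (one_lt_inv₀ hl0).2 hl1,
        fun i hi j hj => ?_⟩
      have hlk := pow_pos hl0 (m - 1)
      have e1 : l⁻¹ ^ (m - 1) * s i = r - t i := by
        rw [hd1 i hi, inv_pow, inv_mul_cancel_left₀ hlk.ne']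
      have e2 : s j / l⁻¹ ^ (m - 1) = r - t j := by
        rw [hd2 j hj, inv_pow, div_inv_eq_mul, mul_comm]
      rw [mul_div_assoc, mul_comm (l⁻¹ ^ (m - 1)) (R j ^ (m - 1)), ← div_div]
      exact ⟨by linarith, by linarith⟩
  have hright : r = hi → (∀ i j, t i + s i = t j + s j) ∨
      ∃ U W : Set (Fin n), A.IsBipartition U W ∧
        ∃ l : ℝ, 0 < l ∧ l < 1 ∧ A.ScaleRelation R t r U W l := by
    intro h
    obtain h1 | ⟨P, l, hl0, hl1, hP, hP', hd1, hd2⟩ := hup.2 fun i j hj =>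
      (pairBound_le_iff (htr i) (htr j)).1 (h ▸ hhi.2 ⟨i, j, hj, rfl⟩)
    · exact Or.inl (hconst h1)
    · refine Or.inr ⟨P, Pᶜ, isBipartition_compl hP hP', l, hl0, hl1, fun i hi j hj => ?_⟩
      have hlk := pow_pos hl0 (m - 1)
      have e1 : l ^ (m - 1) * s i = r - t i := (hd1 i hi).symm
      have e2 : s j / l ^ (m - 1) = r - t j := by
        rw [hd2 j hj, mul_div_cancel_left₀ _ hlk.ne']
      rw [mul_div_assoc, mul_comm (l ^ (m - 1)) (R j ^ (m - 1)), ← div_div]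
      exact ⟨by linarith, by linarith⟩
  -- conversely, either condition makes every pair bound equal to the spectral radius
  have hconv : ((∀ i j, t i + s i = t j + s j) ∨
      ∃ U W : Set (Fin n), A.IsBipartition U W ∧
        ∃ l : ℝ, 0 < l ∧ A.ScaleRelation R t r U W l) → ∀ z ∈ E, z = r := by
    rintro (h | ⟨U, W, hUW, l, hl, h⟩) _ ⟨i, j, hj, rfl⟩
    -- If `t + s` is a constant `c`, then `r > c` makes every `d` exceed `s` and `r < c` the
    -- reverse; the pairs from `hup` and `hlow` exclude both.
    · obtain ⟨a, b, -, hab⟩ := hup.1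
      obtain ⟨c, e, -, hce⟩ := hlow.1
      have hr0 : r = t i + s i := by
        have ha := h a i
        have hb := h b i
        have hc := h c i
        have he := h e i
        refine le_antisymm (le_of_not_gt fun hlt => hab.not_gt ?_)
          (le_of_not_gt fun hlt => hce.not_gt ?_)
        · exact mul_lt_mul'' (by linarith) (by linarith) (hs a).le (hs b).le
        · exact mul_lt_mul'' (by linarith) (by linarith) (hd c).le (hd e).le
      have e1 : r - t i = s i := by linarith
      have e2 : r - t j = s j := by linarith [h i j]
      have hprod : (r - t i) * (r - t j) = s i * s j := by rw [e1, e2]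
      exact le_antisymm ((pairBound_le_iff (htr i) (htr j)).2 hprod.ge)
        ((le_pairBound_iff (htr i) (htr j)).2 hprod.le)
    · exact pairBound_eq_of_scaleRelation hl htr hUW h hj
  refine ⟨hgreat, lo, hi, hlo, hhi, ?_, ?_, ⟨fun h => ?_, fun h => hconv h lo hlo.1⟩,
    ⟨fun h => ?_, fun h => (hconv h hi hhi.1).symm⟩, hleft, hright⟩
  · obtain ⟨i, j, hj, h⟩ := hlow.1
    exact (hlo.2 ⟨i, j, hj, rfl⟩).trans ((pairBound_le_iff (htr i) (htr j)).2 h)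
  · obtain ⟨i, j, hj, h⟩ := hup.1
    exact ((le_pairBound_iff (htr i) (htr j)).2 h).trans (hhi.2 ⟨i, j, hj, rfl⟩)
  · exact (hleft h).imp_right fun ⟨U, W, hUW, l, hl, hrel⟩ =>
      ⟨U, W, hUW, l, zero_lt_one.trans hl, hrel⟩
  · exact (hright h).imp_right fun ⟨U, W, hUW, l, hl, _, hrel⟩ => ⟨U, W, hUW, l, hl, hrel⟩
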